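/- Let $R$ be a commutative ring. A unimodular symmetric $R$-module is a finitely generated projective $R$-module $M$ with a symmetric bilinear form $\varphi\colon M\times M\to R$ such that $M\to M^\vee=\operatorname{Hom}_R(M,R)$, $x\mapsto\varphi(x,-)$, is an isomorphism. Let $\mathrm{GW}^{\mathrm{sym}}(R)$ be the group completion of the commutative monoid of isomorphism classes of unimodular symmetric $R$-modules under orthogonal sum; it is a commutative ring under tensor product. A lagrangian of $(M,\varphi)$ is a finitely generated projective submodule $L\subseteq M$ with $\varphi|_{L\times L}=0$ such that the induced map $M/L\to L^\vee$ is an isomorphism (equivalently, a direct summand $L$ of $M$ with this property); $(M,\varphi)$ is metabolic if it has a lagrangian. Let $\mathrm{W}^{\mathrm{sym}}(R)$ be the quotient of $\mathrm{GW}^{\mathrm{sym}}(R)$ by the ideal generated by the classes of metabolic modules. For a unit $a\in R^\times$ let $\langle a\rangle\in\mathrm{GW}^{\mathrm{sym}}(R)$ be the class of $R$ with the form $(u,v)\mapsto auv$, and let $\langle\langle a\rangle\rangle=\langle 1\rangle-\langle a\rangle$. **Proposition.** There are group isomorphisms $$\mathbb Z\oplus\mathbb Z/4\;\xrightarrow{\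 \sim\ }\;\mathrm{GW}^{\mathrm{sym}}(\mathbb Z/4),\qquad \mathbb Z\oplus\mathbb Z/4\oplus\mathbb Z/2\;\xrightarrow{\ \sim\ }\;\mathrm{GW}^{\mathrm{sym}}(\mathbb Z/8)$$ sending the standard generators to $(\langle1\rangle,\langle\langle3\rangle\rangle)$ and to $(\langle1\rangle,\langle\langle3\rangle\rangle,\langle\langle5\rangle\rangle)$ respectively. Moreover there are group isomorphisms $$\mathbb Z/8\;\xrightarrow{\ \sim\ }\;\mathrm{W}^{\mathrm{sym}}(\mathbb Z/4),\qquad \mathbb Z/8\oplus\mathbb Z/2\;\xrightarrow{\ \sim\ }\;\mathrm{W}^{\mathrm{sym}}(\mathbb Z/8)$$ sending the standard generators to the class of $\langle1\rangle$ and to the classes of $(\langle1\rangle,\langle\langle5\rangle\rangle)$ respectively. -/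

import Mathlib

open scoped TensorProduct

universe u

namespace SymForms

/-! ### Multiplication on the group completion of a commutative semiring -/

section GroupCompletion

open Algebra

variable {S : Type u}

theorem groth_ext [AddCommMonoid S] {G : Type*} [AddCommGroup G]
    {f g : GrothendieckAddGroup S →+ G}
    (h : ∀ s, f (GrothendieckAddGroup.of s) = g (GrothendieckAddGroup.of s)) : f = g := by
  apply GrothendieckAddGroup.lift.symm.injective
  ext s
  exact h s

theorem groth_lift_of [AddCommMonoid S] {G : Type*} [AddCommGroup G] (f : S →+ G) (s : S) :
    GrothendieckAddGroup.lift f (GrothendieckAddGroup.of s) = f s :=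
  DFunLike.congr_fun (GrothendieckAddGroup.lift.symm_apply_apply f) s

variable [CommSemiring S]

/-- The biadditive extension to the group completion of the multiplication of `S`. -/
noncomputable def grothMul :
    GrothendieckAddGroup S →+ GrothendieckAddGroup S →+ GrothendieckAddGroup S :=
  GrothendieckAddGroup.lift
    { toFun := fun s =>
        GrothendieckAddGroup.lift (GrothendieckAddGroup.of.comp (AddMonoidHom.mulLeft s))
      map_zero' := by
        apply groth_ext
        intro t
        rw [groth_lift_of]
        simp
      map_add' := fun s s' => by
        apply groth_ext
        intro t
        rw [AddMonoidHom.add_apply, groth_lift_of, groth_lift_of, groth_lift_of]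
        simp [add_mul] }

theorem grothMul_of (s t : S) :
    grothMul (GrothendieckAddGroup.of s) (GrothendieckAddGroup.of t) =
      GrothendieckAddGroup.of (s * t) := by
  rw [grothMul, groth_lift_of]
  exact groth_lift_of _ _

theorem grothMul_comm (x y : GrothendieckAddGroup S) : grothMul x y = grothMul y x := by
  have : (grothMul : GrothendieckAddGroup S →+ _) = grothMul.flip := by
    apply groth_ext
    intro s
    apply groth_ext
    intro t
    rw [AddMonoidHom.flip_apply, grothMul_of, grothMul_of, mul_comm]
  conv_lhs => rw [this]
  rfl

theorem grothMul_assoc (x y z : GrothendieckAddGroup S) :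
    grothMul (grothMul x y) z = grothMul x (grothMul y z) := by
  have h1 : ∀ s t : S, grothMul (grothMul (GrothendieckAddGroup.of s) (GrothendieckAddGroup.of t)) =
      (grothMul (GrothendieckAddGroup.of s)).comp (grothMul (GrothendieckAddGroup.of t)) := by
    intro s t
    apply groth_ext
    intro r
    rw [AddMonoidHom.comp_apply, grothMul_of, grothMul_of, grothMul_of, grothMul_of, mul_assoc]
  have h2 : ∀ s : S, (grothMul.flip z).comp (grothMul (GrothendieckAddGroup.of s)) =
      (grothMul (GrothendieckAddGroup.of s)).comp (grothMul.flip z) := by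
    intro s
    apply groth_ext
    intro t
    exact DFunLike.congr_fun (h1 s t) z
  have h3 : (grothMul.flip z).comp (grothMul.flip y) = grothMul.flip (grothMul y z) := by
    apply groth_ext
    intro s
    exact DFunLike.congr_fun (h2 s) y
  exact DFunLike.congr_fun h3 x

theorem grothMul_one (x : GrothendieckAddGroup S) :
    grothMul (GrothendieckAddGroup.of (1 : S)) x = x := by
  have : grothMul (GrothendieckAddGroup.of (1 : S)) = AddMonoidHom.id _ := by
    apply groth_ext
    intro s
    rw [grothMul_of, one_mul]
    rfl
  rw [this]
  rfl

/-- The group completion of a commutative semiring is a commutative ring. -/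
noncomputable instance grothCommRing : CommRing (GrothendieckAddGroup S) where
  __ := (inferInstance : AddCommGroup (GrothendieckAddGroup S))
  mul x y := grothMul x y
  one := GrothendieckAddGroup.of 1
  left_distrib x y z := (grothMul x).map_add y z
  right_distrib x y z := by
    change grothMul (x + y) z = grothMul x z + grothMul y z
    rw [map_add]
    rfl
  zero_mul x := by
    change grothMul 0 x = 0
    rw [map_zero]
    rfl
  mul_zero x := (grothMul x).map_zero
  mul_assoc := grothMul_assoc
  one_mul := grothMul_one
  mul_one x := (grothMul_comm x _).trans (grothMul_one x)
  mul_comm := grothMul_comm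

theorem groth_of_mul (s t : S) :
    (GrothendieckAddGroup.of (s * t) : GrothendieckAddGroup S) =
      GrothendieckAddGroup.of s * GrothendieckAddGroup.of t :=
  (grothMul_of s t).symm

end GroupCompletion

/-! ### Unimodular symmetric modules -/

/-- A finitely generated projective `R`-module with a unimodular symmetric bilinear form:
the form `M → M → R` induces an isomorphism from `M` to its dual. -/
structure USymModule (R : Type u) [CommRing R] where
  carrier : Type u
  [addCommGroup : AddCommGroup carrier]
  [module : Module R carrier]
  [finite : Module.Finite R carrier]
  [projective : Module.Projective R carrier]
  form : LinearMap.BilinForm R carrier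
  isSymm : form.IsSymm
  unimodular : Function.Bijective (form : carrier → Module.Dual R carrier)

attribute [instance] USymModule.addCommGroup USymModule.module USymModule.finite
  USymModule.projective

namespace USymModule

variable {R : Type u} [CommRing R]

/-- Isomorphism (isometry) of unimodular symmetric modules. -/
def Iso (M N : USymModule R) : Prop :=
  ∃ e : M.carrier ≃ₗ[R] N.carrier, ∀ x y, N.form (e x) (e y) = M.form x y

theorem Iso.refl (M : USymModule R) : Iso M M := ⟨LinearEquiv.refl R _, fun _ _ => rfl⟩

theorem Iso.symm {M N : USymModule R} : Iso M N → Iso N M := by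
  rintro ⟨e, he⟩
  exact ⟨e.symm, fun x y => by rw [← he]; simp⟩

theorem Iso.trans {M N P : USymModule R} : Iso M N → Iso N P → Iso M P := by
  rintro ⟨e, he⟩ ⟨f, hf⟩
  exact ⟨e.trans f, fun x y => by simp [hf, he]⟩

/-- The setoid of isomorphism. -/
instance setoid (R : Type u) [CommRing R] : Setoid (USymModule R) :=
  ⟨Iso, Iso.refl, Iso.symm, Iso.trans⟩

/-- The form `(x, y), (x', y') ↦ φ x x' + ψ y y'` on `M × N`. -/
def sumForm (M N : USymModule R) : LinearMap.BilinForm R (M.carrier × N.carrier) :=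
  M.form.compl₁₂ (LinearMap.fst R _ _) (LinearMap.fst R _ _) +
    N.form.compl₁₂ (LinearMap.snd R _ _) (LinearMap.snd R _ _)

theorem sumForm_apply (M N : USymModule R) (x y : M.carrier × N.carrier) :
    sumForm M N x y = M.form x.1 y.1 + N.form x.2 y.2 := rfl

/-- The orthogonal sum of two unimodular symmetric modules. -/
def orthSum (M N : USymModule R) : USymModule R where
  carrier := M.carrier × N.carrier
  form := sumForm M N
  isSymm := ⟨fun x y => by
    rw [sumForm_apply, sumForm_apply, M.isSymm.eq x.1 y.1, N.isSymm.eq x.2 y.2]⟩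
  unimodular := by
    constructor
    · intro x y h
      have h1 : M.form x.1 = M.form y.1 := by
        ext z
        simpa [sumForm_apply] using DFunLike.congr_fun h (z, 0)
      have h2 : N.form x.2 = N.form y.2 := by
        ext z
        simpa [sumForm_apply] using DFunLike.congr_fun h (0, z)
      exact Prod.ext (M.unimodular.1 h1) (N.unimodular.1 h2)
    · intro f
      obtain ⟨a, ha⟩ := M.unimodular.2 (f.comp (LinearMap.inl R _ _))
      obtain ⟨b, hb⟩ := N.unimodular.2 (f.comp (LinearMap.inr R _ _))
      refine ⟨(a, b), ?_⟩
      refine LinearMap.ext fun z => ?_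
      rw [sumForm_apply]
      change M.form a z.1 + N.form b z.2 = f z
      rw [ha, hb]
      change f (z.1, 0) + f (0, z.2) = f z
      rw [← map_add]
      simp

/-- The zero module. -/
def zero (R : Type u) [CommRing R] : USymModule R where
  carrier := PUnit.{u + 1}
  form := 0
  isSymm := ⟨fun _ _ => by simp⟩
  unimodular := ⟨fun _ _ _ => rfl, fun f => ⟨0, LinearMap.ext fun x =>
    (map_zero (0 : Module.Dual R PUnit.{u + 1})).trans (map_zero f).symm⟩⟩

/-- For a unit `a`, the module `R` with the form `u, v ↦ a u v`. -/
def rankOne (a : Rˣ) : USymModule R where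
  carrier := R
  form := (a : R) • LinearMap.mul R R
  isSymm := ⟨fun x y => by simp [mul_comm]⟩
  unimodular := by
    constructor
    · intro x y h
      simpa using DFunLike.congr_fun h 1
    · intro f
      refine ⟨(↑a⁻¹ : R) * f 1, ?_⟩
      ext
      simp

theorem rankOne_form (a : Rˣ) (x y : R) : (rankOne a).form x y = (a : R) * (x * y) := rfl

/-- The form `x ⊗ y, x' ⊗ y' ↦ φ x x' * ψ y y'` on `M ⊗ N`. -/
noncomputable def tensorForm (M N : USymModule R) :
    LinearMap.BilinForm R (M.carrier ⊗[R] N.carrier) :=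
  LinearMap.BilinForm.tmul M.form N.form

theorem tensorForm_tmul (M N : USymModule R) (x x' : M.carrier) (y y' : N.carrier) :
    tensorForm M N (x ⊗ₜ y) (x' ⊗ₜ y') = M.form x x' * N.form y y' := by
  simp [tensorForm, mul_comm]

theorem tensorForm_unimodular (M N : USymModule R) :
    Function.Bijective (tensorForm M N : _ → Module.Dual R (M.carrier ⊗[R] N.carrier)) := by
  let eM : M.carrier ≃ₗ[R] Module.Dual R M.carrier := LinearEquiv.ofBijective M.form M.unimodular
  let eN : N.carrier ≃ₗ[R] Module.Dual R N.carrier := LinearEquiv.ofBijective N.form N.unimodular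
  let E := (TensorProduct.congr eM eN).trans
    ((dualTensorHomEquiv R M.carrier (Module.Dual R N.carrier)).trans
      (TensorProduct.lift.equiv (RingHom.id R) M.carrier N.carrier R))
  have hE : (E : _ →ₗ[R] Module.Dual R (M.carrier ⊗[R] N.carrier)) = tensorForm M N := by
    ext x y x' y'
    change E (x ⊗ₜ y) (x' ⊗ₜ y') = tensorForm M N (x ⊗ₜ y) (x' ⊗ₜ y')
    rw [tensorForm_tmul]
    simp [E, eM, eN]
  have : (tensorForm M N : _ → Module.Dual R (M.carrier ⊗[R] N.carrier)) = E := by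
    rw [← hE]
    rfl
  rw [this]
  exact E.bijective

/-- The tensor product of two unimodular symmetric modules. -/
noncomputable def tensor (M N : USymModule R) : USymModule R where
  carrier := M.carrier ⊗[R] N.carrier
  form := tensorForm M N
  isSymm := LinearMap.BilinForm.isSymm_iff.2 (LinearMap.IsSymm.tmul ⟨M.isSymm.eq⟩ ⟨N.isSymm.eq⟩)
  unimodular := tensorForm_unimodular M N

theorem tensor_form_tmul (M N : USymModule R) (x x' : M.carrier) (y y' : N.carrier) :
    (tensor M N).form (x ⊗ₜ y) (x' ⊗ₜ y') = M.form x x' * N.form y y' :=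
  tensorForm_tmul M N x x' y y'

/-- To check that a linear equivalence from a tensor product is an isometry, it suffices to
test pure tensors. -/
theorem isometry_of_tmul {M N P : USymModule R} (e : M.carrier ⊗[R] N.carrier →ₗ[R] P.carrier)
    (h : ∀ x y x' y', P.form (e (x ⊗ₜ y)) (e (x' ⊗ₜ y')) = M.form x x' * N.form y y')
    (z w : M.carrier ⊗[R] N.carrier) : P.form (e z) (e w) = (tensor M N).form z w := by
  have : P.form.compl₁₂ e e = tensorForm M N := by
    ext x y x' y'
    change P.form (e (x ⊗ₜ y)) (e (x' ⊗ₜ y')) = tensorForm M N (x ⊗ₜ y) (x' ⊗ₜ y')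
    rw [h, tensorForm_tmul]
  exact DFunLike.congr_fun (DFunLike.congr_fun this z) w

theorem orthSum_congr {M M' N N' : USymModule R} :
    Iso M M' → Iso N N' → Iso (orthSum M N) (orthSum M' N') := by
  rintro ⟨e, he⟩ ⟨f, hf⟩
  refine ⟨e.prodCongr f, fun x y => ?_⟩
  change M'.form (e x.1) (e y.1) + N'.form (f x.2) (f y.2) = M.form x.1 y.1 + N.form x.2 y.2
  rw [he, hf]

theorem tensor_congr {M M' N N' : USymModule R} :
    Iso M M' → Iso N N' → Iso (tensor M N) (tensor M' N') := by
  rintro ⟨e, he⟩ ⟨f, hf⟩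
  refine ⟨TensorProduct.congr e f, isometry_of_tmul (P := tensor M' N')
    (TensorProduct.congr e f).toLinearMap fun x y x' y' => ?_⟩
  change (tensor M' N').form (e x ⊗ₜ f y) (e x' ⊗ₜ f y') = _
  rw [tensor_form_tmul, he, hf]

theorem orthSum_comm (M N : USymModule R) : Iso (orthSum M N) (orthSum N M) :=
  ⟨LinearEquiv.prodComm R _ _, fun _ _ => add_comm _ _⟩

theorem orthSum_assoc (M N P : USymModule R) :
    Iso (orthSum (orthSum M N) P) (orthSum M (orthSum N P)) :=
  ⟨LinearEquiv.prodAssoc R _ _ _, fun _ _ => (add_assoc _ _ _).symm⟩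

theorem zero_orthSum (M : USymModule R) : Iso (orthSum (zero R) M) M :=
  ⟨LinearEquiv.uniqueProd (R := R) (M := M.carrier) (M₂ := PUnit.{u + 1}),
    fun _ _ => (zero_add _).symm⟩

theorem tensor_comm (M N : USymModule R) : Iso (tensor M N) (tensor N M) :=
  ⟨TensorProduct.comm R _ _, isometry_of_tmul (P := tensor N M)
    (TensorProduct.comm R _ _).toLinearMap fun x y x' y' => by
      change (tensor N M).form (y ⊗ₜ x) (y' ⊗ₜ x') = _
      rw [tensor_form_tmul, mul_comm]⟩

theorem tensor_assoc (M N P : USymModule R) :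
    Iso (tensor (tensor M N) P) (tensor M (tensor N P)) := by
  let e := TensorProduct.assoc R M.carrier N.carrier P.carrier
  have h : (tensor M (tensor N P)).form.compl₁₂ e.toLinearMap e.toLinearMap =
      tensorForm (tensor M N) P := by
    ext x y z x' y' z'
    change (tensor M (tensor N P)).form (x ⊗ₜ (y ⊗ₜ z)) (x' ⊗ₜ (y' ⊗ₜ z')) =
      (tensor (tensor M N) P).form ((x ⊗ₜ y) ⊗ₜ z) ((x' ⊗ₜ y') ⊗ₜ z')
    erw [tensor_form_tmul, tensor_form_tmul, tensor_form_tmul, tensor_form_tmul]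
    exact (mul_assoc _ _ _).symm
  exact ⟨e, fun z w => DFunLike.congr_fun (DFunLike.congr_fun h z) w⟩

theorem one_tensor (M : USymModule R) : Iso (tensor (rankOne 1) M) M :=
  ⟨TensorProduct.lid R M.carrier, isometry_of_tmul (M := rankOne 1)
    (TensorProduct.lid R M.carrier).toLinearMap fun x y x' y' => by
      have key : ∀ r r' : R, M.form (r • y) (r' • y') =
          (((1 : Rˣ) : R) * (r * r')) * M.form y y' := fun r r' => by
        simp
        ring
      exact key x x'⟩

theorem zero_tensor (M : USymModule R) : Iso (tensor (zero R) M) (zero R) := by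
  have hs : ∀ z : PUnit.{u + 1} ⊗[R] M.carrier, z = 0 := fun z => by
    induction z with
    | zero => rfl
    | tmul x y => rw [Subsingleton.elim x 0, TensorProduct.zero_tmul]
    | add a b ha hb => rw [ha, hb, add_zero]
  have : Subsingleton (tensor (zero R) M).carrier := ⟨fun a b => (hs a).trans (hs b).symm⟩
  have : Subsingleton (zero R).carrier := inferInstanceAs (Subsingleton PUnit)
  refine ⟨{ (0 : _ →ₗ[R] _) with
    invFun := 0
    left_inv := fun _ => Subsingleton.elim _ _
    right_inv := fun _ => Subsingleton.elim _ _ }, fun x y => ?_⟩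
  rw [Subsingleton.elim x 0]
  simp

theorem orthSum_tensor (M N P : USymModule R) :
    Iso (tensor (orthSum M N) P) (orthSum (tensor M P) (tensor N P)) := by
  let e := TensorProduct.prodLeft R R M.carrier N.carrier P.carrier
  refine ⟨e, isometry_of_tmul (M := orthSum M N) (P := orthSum (tensor M P) (tensor N P))
    e.toLinearMap fun x y x' y' => ?_⟩
  change (tensor M P).form (x.1 ⊗ₜ y) (x'.1 ⊗ₜ y') + (tensor N P).form (x.2 ⊗ₜ y) (x'.2 ⊗ₜ y') =
    (M.form x.1 x'.1 + N.form x.2 x'.2) * P.form y y'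
  rw [tensor_form_tmul, tensor_form_tmul, add_mul]

/-- For a submodule `L` of `M`, the map `M → Hom(L, R)`, `x ↦ φ(x, ·)`. -/
def toDualOf (M : USymModule R) (L : Submodule R M.carrier) :
    M.carrier →ₗ[R] Module.Dual R L :=
  L.dualRestrict ∘ₗ M.form

/-- `L` is a lagrangian: it is finitely generated projective, the form vanishes on `L × L`, and
the induced map `M ⧸ L → Hom(L, R)` is an isomorphism. -/
structure IsLagrangian (M : USymModule R) (L : Submodule R M.carrier) : Prop where
  finite : Module.Finite R L
  projective : Module.Projective R L
  isotropic : L ≤ LinearMap.ker (M.toDualOf L)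
  bijective : Function.Bijective (L.liftQ (M.toDualOf L) isotropic)

/-- A metabolic module is one that has a lagrangian. -/
def IsMetabolic (M : USymModule R) : Prop := ∃ L : Submodule R M.carrier, M.IsLagrangian L

end USymModule

/-! ### The Grothendieck-Witt and Witt rings -/

/-- Isomorphism classes of unimodular symmetric modules. -/
def SymClass (R : Type u) [CommRing R] : Type (u + 1) := Quotient (USymModule.setoid R)

section Classes

variable {R : Type u} [CommRing R]

/-- The isomorphism class of a unimodular symmetric module. -/
def SymClass.mk (M : USymModule R) : SymClass R := Quotient.mk _ M

/-- Isomorphism classes form a commutative semiring under orthogonal sum and tensor product. -/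
noncomputable instance SymClass.commSemiring (R : Type u) [CommRing R] :
    CommSemiring (SymClass R) where
  add := Quotient.map₂ USymModule.orthSum fun _ _ h _ _ h' => USymModule.orthSum_congr h h'
  zero := SymClass.mk (USymModule.zero R)
  mul := Quotient.map₂ USymModule.tensor fun _ _ h _ _ h' => USymModule.tensor_congr h h'
  one := SymClass.mk (USymModule.rankOne 1)
  nsmul := @nsmulRec _ ⟨SymClass.mk (USymModule.zero R)⟩
    ⟨Quotient.map₂ USymModule.orthSum fun _ _ h _ _ h' => USymModule.orthSum_congr h h'⟩
  add_assoc := by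
    rintro ⟨a⟩ ⟨b⟩ ⟨c⟩
    exact Quotient.sound (USymModule.orthSum_assoc a b c)
  zero_add := by
    rintro ⟨a⟩
    exact Quotient.sound (USymModule.zero_orthSum a)
  add_zero := by
    rintro ⟨a⟩
    exact Quotient.sound ((USymModule.orthSum_comm _ _).trans (USymModule.zero_orthSum a))
  add_comm := by
    rintro ⟨a⟩ ⟨b⟩
    exact Quotient.sound (USymModule.orthSum_comm a b)
  mul_assoc := by
    rintro ⟨a⟩ ⟨b⟩ ⟨c⟩
    exact Quotient.sound (USymModule.tensor_assoc a b c)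
  one_mul := by
    rintro ⟨a⟩
    exact Quotient.sound (USymModule.one_tensor a)
  mul_one := by
    rintro ⟨a⟩
    exact Quotient.sound ((USymModule.tensor_comm _ _).trans (USymModule.one_tensor a))
  mul_comm := by
    rintro ⟨a⟩ ⟨b⟩
    exact Quotient.sound (USymModule.tensor_comm a b)
  zero_mul := by
    rintro ⟨a⟩
    exact Quotient.sound (USymModule.zero_tensor a)
  mul_zero := by
    rintro ⟨a⟩
    exact Quotient.sound ((USymModule.tensor_comm _ _).trans (USymModule.zero_tensor a))
  right_distrib := by
    rintro ⟨a⟩ ⟨b⟩ ⟨c⟩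
    exact Quotient.sound (USymModule.orthSum_tensor a b c)
  left_distrib := by
    rintro ⟨a⟩ ⟨b⟩ ⟨c⟩
    exact Quotient.sound ((USymModule.tensor_comm _ _).trans
      ((USymModule.orthSum_tensor b c a).trans
        (USymModule.orthSum_congr (USymModule.tensor_comm _ _) (USymModule.tensor_comm _ _))))

theorem SymClass.mk_eq_mk {M N : USymModule R} :
    SymClass.mk M = SymClass.mk N ↔ USymModule.Iso M N :=
  Quotient.eq

theorem SymClass.mk_add (M N : USymModule R) :
    SymClass.mk M + SymClass.mk N = SymClass.mk (M.orthSum N) := rfl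

theorem SymClass.mk_mul (M N : USymModule R) :
    SymClass.mk M * SymClass.mk N = SymClass.mk (M.tensor N) := rfl

end Classes

/-- The symmetric Grothendieck-Witt ring: the group completion of the semiring of isomorphism
classes of unimodular symmetric modules. -/
abbrev GW (R : Type u) [CommRing R] : Type (u + 1) := Algebra.GrothendieckAddGroup (SymClass R)

/-- The class of a unimodular symmetric module in `GW R`. -/
noncomputable def GW.cls {R : Type u} [CommRing R] (M : USymModule R) : GW R :=
  Algebra.GrothendieckAddGroup.of (SymClass.mk M)

/-- The element `⟨a⟩` of `GW R`, for a unit `a`. -/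
noncomputable def GW.symb {R : Type u} [CommRing R] (a : Rˣ) : GW R :=
  GW.cls (USymModule.rankOne a)

/-- The element `⟨⟨a⟩⟩ = ⟨1⟩ - ⟨a⟩` of `GW R`, for a unit `a`. -/
noncomputable def GW.pfister {R : Type u} [CommRing R] (a : Rˣ) : GW R :=
  GW.symb 1 - GW.symb a

/-- The ideal of `GW R` generated by the classes of metabolic modules. -/
noncomputable def metabolicIdeal (R : Type u) [CommRing R] : Ideal (GW R) :=
  Ideal.span {x | ∃ M : USymModule R, M.IsMetabolic ∧ x = GW.cls M}

/-- The symmetric Witt ring, the quotient of `GW R` by the ideal generated by metabolic modules. -/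
abbrev W (R : Type u) [CommRing R] : Type (u + 1) := GW R ⧸ metabolicIdeal R

/-- The projection from `GW R` to `W R`. -/
noncomputable def GW.toW (R : Type u) [CommRing R] : GW R →+* W R :=
  Ideal.Quotient.mk (metabolicIdeal R)

end SymForms

/-! Generators and relations give the surjections, and Gauss sums give their injectivity.

Generation. Over a local ring a vector whose norm is a unit splits off a summand `⟨a⟩`. If there is
no such vector, adding `⟨1⟩` creates one. Hence every form is stably diagonal and the classes `⟨a⟩`
generate `GW R` (`GW.mem_of_symb_mem`).

Relations. A 4 by 4 similitude of factor 3 gives `4⟨3⟩ = 4⟨1⟩`. Over `ZMod 8`, explicit binary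
isometries give `2⟨5⟩ = 2⟨1⟩` and `⟨5⟩ + ⟨-1⟩ = ⟨1⟩ + ⟨3⟩`. In the Witt ring also `⟨-a⟩ = -⟨a⟩`,
because `⟨a, -a⟩` is metabolic.

Independence. For an additive character `ψ`, the sum of `ψ (φ x x)` over `M` turns orthogonal sums
into products. When it is nonzero on rank one forms, it is invertible on all forms and defines a
homomorphism from `GW R` to the nonzero complex numbers. Its modulus detects the rank and its
argument detects torsion. On a metabolic form, averaging over translates by a lagrangian leaves only
terms equal to 1, so the sum is a positive real (`gauss_pos_of_isMetabolic`). Its argument is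
therefore an invariant of Witt classes. One character suffices for `ZMod 4`. For `ZMod 8` two are
used: a faithful one takes the same value -1 on `⟨⟨5⟩⟩` and on `2⟨⟨3⟩⟩`, and a second one, of order
4, separates them. -/

namespace SymForms

namespace USymModule

variable {R : Type u} [CommRing R]

/-! ### Splitting off rank one summands -/

theorem form_comm (M : USymModule R) (x y : M.carrier) : M.form x y = M.form y x :=
  M.isSymm.eq x y

/-- The vectors orthogonal to `x`. -/
def perp (M : USymModule R) (x : M.carrier) : Submodule R M.carrier := LinearMap.ker (M.form x)

/-- The projection onto the orthogonal complement of a vector whose norm is a unit. -/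
def perpProj (M : USymModule R) {x : M.carrier} {a : Rˣ} (h : M.form x x = a) :
    M.carrier →ₗ[R] M.perp x :=
  LinearMap.codRestrict (M.perp x)
    (LinearMap.id - ((↑a⁻¹ : R) • M.form x).smulRight x) fun y => by
      simp only [perp, LinearMap.mem_ker, LinearMap.sub_apply, LinearMap.id_apply,
        LinearMap.smulRight_apply, LinearMap.smul_apply, map_sub, map_smul, h, smul_eq_mul]
      rw [mul_right_comm, Units.inv_mul, one_mul, sub_self]

theorem coe_perpProj (M : USymModule R) {x : M.carrier} {a : Rˣ} (h : M.form x x = a)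
    (y : M.carrier) : (M.perpProj h y : M.carrier) = y - ((↑a⁻¹ : R) * M.form x y) • x := rfl

theorem perpProj_comp_subtype (M : USymModule R) {x : M.carrier} {a : Rˣ} (h : M.form x x = a) :
    M.perpProj h ∘ₗ (M.perp x).subtype = LinearMap.id := by
  ext y
  have : M.form x y = 0 := y.2
  simp [coe_perpProj, this]

theorem form_perpProj (M : USymModule R) {x : M.carrier} {a : Rˣ} (h : M.form x x = a)
    (y : M.carrier) (n : M.perp x) : M.form (M.perpProj h y) n = M.form y n := by
  have : M.form x n = 0 := n.2
  simp [coe_perpProj, this]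

/-- The orthogonal complement of a vector whose norm is a unit. -/
def perpModule (M : USymModule R) {x : M.carrier} {a : Rˣ} (h : M.form x x = a) :
    USymModule R where
  carrier := M.perp x
  finite := Module.Finite.of_surjective (M.perpProj h) fun y =>
    ⟨y, DFunLike.congr_fun (M.perpProj_comp_subtype h) y⟩
  projective := Module.Projective.of_split _ _ (M.perpProj_comp_subtype h)
  form := M.form.compl₁₂ (M.perp x).subtype (M.perp x).subtype
  isSymm := ⟨fun y z => M.isSymm.eq y z⟩
  unimodular := by
    constructor
    · intro y z hyz
      apply Subtype.ext
      apply M.unimodular.1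
      refine LinearMap.ext fun w => ?_
      -- Pairing with a vector of the complement does not see the `x`-component of `w`, so `w` may
      -- be replaced by its projection.
      have := DFunLike.congr_fun hyz (M.perpProj h w)
      change M.form y (M.perpProj h w) = M.form z (M.perpProj h w) at this
      rw [M.form_comm y, M.form_comm z, form_perpProj, form_perpProj] at this
      rw [M.form_comm y, M.form_comm z]
      exact this
    · intro f
      -- Extend `f` by zero on `x`, represent the extension by `m`, and project `m` back.
      obtain ⟨m, hm⟩ := M.unimodular.2 (f ∘ₗ M.perpProj h)
      refine ⟨M.perpProj h m, LinearMap.ext fun n => ?_⟩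
      change M.form (M.perpProj h m) n = f n
      rw [form_perpProj, hm]
      exact congrArg f (DFunLike.congr_fun (M.perpProj_comp_subtype h) n)

/-- A vector whose norm is a unit splits off. -/
theorem iso_rankOne_orthSum_perpModule (M : USymModule R) {x : M.carrier} {a : Rˣ}
    (h : M.form x x = a) : Iso (orthSum (rankOne a) (M.perpModule h)) M := by
  let f : (R × M.perp x) →ₗ[R] M.carrier :=
    (LinearMap.toSpanSingleton R M.carrier x).coprod (M.perp x).subtype
  let g : M.carrier →ₗ[R] (R × M.perp x) :=
    ((↑a⁻¹ : R) • M.form x).prod (M.perpProj h)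
  have hgf : g ∘ₗ f = LinearMap.id := by
    refine LinearMap.ext fun y => Prod.ext ?_ (Subtype.ext ?_)
    · have : M.form x y.2 = 0 := y.2.2
      simp [f, g, this, h, mul_left_comm]
    · have : M.form x y.2 = 0 := y.2.2
      simp [f, g, coe_perpProj, this, h, mul_left_comm]
  have hfg : f ∘ₗ g = LinearMap.id := by
    refine LinearMap.ext fun y => ?_
    simp [f, g, coe_perpProj]
  refine ⟨LinearEquiv.ofLinearMap f g hfg hgf, fun (y z : R × M.perp x) => ?_⟩
  change M.form (y.1 • x + (y.2 : M.carrier)) (z.1 • x + (z.2 : M.carrier)) =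
    (a : R) * (y.1 * z.1) + M.form y.2 z.2
  have h1 : M.form x z.2 = 0 := z.2.2
  have h2 : M.form y.2 x = 0 := by
    rw [M.form_comm]
    exact y.2.2
  simp only [map_add, map_smul, LinearMap.add_apply, LinearMap.smul_apply, smul_eq_mul, h, h1, h2]
  ring

end USymModule

open USymModule

open scoped ComplexOrder

/-! ### Stable diagonalization over local rings -/

section Diagonal

variable {R : Type u} [CommRing R]

variable (R) in
/-- The isomorphism classes of diagonal forms. -/
noncomputable def diagClasses : AddSubmonoid (SymClass R) :=
  AddSubmonoid.closure (Set.range fun a : Rˣ => SymClass.mk (rankOne a))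

theorem mk_rankOne_mem (a : Rˣ) : SymClass.mk (rankOne a) ∈ diagClasses R :=
  AddSubmonoid.subset_closure ⟨a, rfl⟩

theorem mk_eq_add_perpModule (M : USymModule R) {x : M.carrier} {a : Rˣ} (h : M.form x x = a) :
    SymClass.mk M = SymClass.mk (rankOne a) + SymClass.mk (M.perpModule h) :=
  (SymClass.mk_eq_mk.2 (M.iso_rankOne_orthSum_perpModule h)).symm

theorem finrank_perpModule [IsLocalRing R] (M : USymModule R) {x : M.carrier} {a : Rˣ}
    (h : M.form x x = a) :
    Module.finrank R M.carrier = 1 + Module.finrank R (M.perpModule h).carrier := by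
  obtain ⟨e, -⟩ := M.iso_rankOne_orthSum_perpModule h
  have : Module.Free R (M.perpModule h).carrier := Module.free_of_flat_of_isLocalRing
  rw [← e.finrank_eq]
  change Module.finrank R (R × (M.perpModule h).carrier) = _
  rw [Module.finrank_prod, Module.finrank_self]

/-- The module is free, and unimodularity represents a coordinate functional of a basis. -/
theorem exists_form_eq_one [IsLocalRing R] (M : USymModule R)
    (hM : 0 < Module.finrank R M.carrier) : ∃ x y, M.form x y = 1 := by
  have : Module.Free R M.carrier := Module.free_of_flat_of_isLocalRing
  let b := Module.finBasis R M.carrier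
  obtain ⟨x, hx⟩ := M.unimodular.2 (b.coord ⟨0, hM⟩)
  exact ⟨x, b ⟨0, hM⟩, by rw [hx]; simp⟩

/-- Over a local ring, every unimodular symmetric module is stably diagonalizable. -/
theorem exists_add_mem_diagClasses [IsLocalRing R] (M : USymModule R) :
    ∃ d ∈ diagClasses R, SymClass.mk M + d ∈ diagClasses R := by
  induction hn : Module.finrank R M.carrier using Nat.strong_induction_on generalizing M with
  | _ n ih =>
  subst hn
  by_cases hM : Module.finrank R M.carrier = 0
  · have : Module.Free R M.carrier := Module.free_of_flat_of_isLocalRing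
    have := (Module.finrank_eq_zero_iff_of_free R M.carrier).1 hM
    refine ⟨0, zero_mem _, ?_⟩
    have h0 : SymClass.mk M = 0 := by
      refine SymClass.mk_eq_mk.2 ⟨?_, ?_⟩
      · have : Subsingleton (zero R).carrier := inferInstanceAs (Subsingleton PUnit)
        exact 0
      · intro x y
        rw [Subsingleton.elim x 0]
        simp
    rw [h0, add_zero]
    exact zero_mem _
  by_cases hodd : ∃ x, IsUnit (M.form x x)
  · obtain ⟨x, a, ha⟩ := hodd
    have hlt := finrank_perpModule M ha.symm
    obtain ⟨d, hd, hd'⟩ := ih _ (by omega) (M.perpModule ha.symm) rfl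
    refine ⟨d, hd, ?_⟩
    rw [mk_eq_add_perpModule M ha.symm, add_assoc]
    exact add_mem (mk_rankOne_mem a) hd'
  · push Not at hodd
    obtain ⟨x, y, hxy⟩ := exists_form_eq_one M (Nat.pos_of_ne_zero hM)
    -- No norm is a unit, so every norm lies in the maximal ideal and becomes a unit after adding 1.
    have hunit : ∀ z, IsUnit (M.form z z + 1) := fun z => by
      have h : IsUnit ((M.form z z + 1) + -M.form z z) := by simp
      exact (IsLocalRing.isUnit_or_isUnit_of_isUnit_add h).resolve_right
        fun h' => hodd z (IsUnit.neg_iff _ |>.1 h')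
    obtain ⟨a, ha⟩ := hunit x
    obtain ⟨b, hb⟩ := hunit y
    let M' := orthSum M (rankOne 1)
    have hform : ∀ (u v : M.carrier) (r s : R),
        M'.form ((u, r) : M.carrier × R) ((v, s) : M.carrier × R) = M.form u v + r * s :=
      fun u v r s => by
        change M.form u v + ((1 : Rˣ) : R) * (r * s) = _
        simp
    have hx : M'.form ((x, 1) : M.carrier × R) ((x, 1) : M.carrier × R) = a := by
      rw [hform, ha, mul_one]
    let N := M'.perpModule hx
    -- Since `φ x y = 1`, the vector `(y, -1)` is orthogonal to `(x, 1)`, and its norm `φ y y + 1`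
    -- is again a unit.
    let v : M'.perp ((x, 1) : M.carrier × R) := ⟨((y, -1) : M.carrier × R), by
      change M'.form ((x, 1) : M.carrier × R) ((y, -1) : M.carrier × R) = 0
      rw [hform, hxy]
      simp⟩
    have hv : N.form v v = b := by
      change M'.form ((y, -1) : M.carrier × R) ((y, -1) : M.carrier × R) = b
      rw [hform, hb]
      simp
    -- One summand was added and two split off, so the remaining rank is one less than that of `M`
    -- and the induction applies.
    have h1 : _ = 1 + Module.finrank R N.carrier := finrank_perpModule M' hx
    have h2 := finrank_perpModule N hv
    have h3 : Module.finrank R M'.carrier = Module.finrank R M.carrier + 1 := by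
      have : Module.Free R M.carrier := Module.free_of_flat_of_isLocalRing
      change Module.finrank R (M.carrier × R) = _
      rw [Module.finrank_prod, Module.finrank_self]
    obtain ⟨d, hd, hd'⟩ := ih _ (by omega) (N.perpModule hv) rfl
    refine ⟨SymClass.mk (rankOne 1) + d, add_mem (mk_rankOne_mem 1) hd, ?_⟩
    rw [← add_assoc, SymClass.mk_add, mk_eq_add_perpModule M' hx, mk_eq_add_perpModule N hv,
      add_assoc, add_assoc]
    exact add_mem (mk_rankOne_mem a) (add_mem (mk_rankOne_mem b) hd')

/-- A subgroup of the group completion which contains the image of the monoid is everything. -/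
theorem groth_mem {S : Type*} [AddCommMonoid S] (H : AddSubgroup (Algebra.GrothendieckAddGroup S))
    (h : ∀ s, Algebra.GrothendieckAddGroup.of s ∈ H) (x : Algebra.GrothendieckAddGroup S) :
    x ∈ H := by
  have : QuotientAddGroup.mk' H = 0 :=
    groth_ext fun s => (QuotientAddGroup.eq_zero_iff _).2 (h s)
  exact (QuotientAddGroup.eq_zero_iff x).1 (DFunLike.congr_fun this x)

/-- Over a local ring, `GW R` is generated by the classes `⟨a⟩`. -/
theorem GW.mem_of_symb_mem [IsLocalRing R] (H : AddSubgroup (GW R)) (h : ∀ a, GW.symb a ∈ H)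
    (x : GW R) : x ∈ H := by
  have hd : ∀ d ∈ diagClasses R, Algebra.GrothendieckAddGroup.of d ∈ H := fun d hd => by
    induction hd using AddSubmonoid.closure_induction with
    | mem x hx =>
      obtain ⟨a, rfl⟩ := hx
      exact h a
    | zero => rw [map_zero]; exact zero_mem _
    | add x y _ _ hx hy => rw [map_add]; exact add_mem hx hy
  refine groth_mem H (fun s => ?_) x
  obtain ⟨M⟩ := s
  obtain ⟨d, hd1, hd2⟩ := exists_add_mem_diagClasses M
  have := hd _ hd2
  rw [map_add] at this
  exact (AddSubgroup.add_mem_cancel_right H (hd d hd1)).1 this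

end Diagonal

section GaussSums

variable {R : Type u} [CommRing R]

/-! ### Additive characters and functionals -/

/-- `c` divides precisely the `r` for which `ψ (2 * r * s) = 1` for all `s`, and moreover
`ψ (c ^ 2 * s) = 1` for all `s`. -/
structure IsConductor (ψ : AddChar R ℂ) (c : R) : Prop where
  dvd : ∀ r, (∀ s, ψ (2 * r * s) = 1) → c ∣ r
  two_mul : ∀ s, ψ (2 * c * s) = 1
  sq_mul : ∀ s, ψ (c * c * s) = 1

/-- Scaling a form by `a` amounts to shifting `ψ` by `a`; positivity for scaled metabolic forms
needs the same conductor for the shifted character. -/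
theorem IsConductor.mulShift {ψ : AddChar R ℂ} {c : R} (h : IsConductor ψ c) (a : Rˣ) :
    IsConductor (ψ.mulShift a) c where
  dvd r hr := h.dvd r fun s => by
    have := hr (↑a⁻¹ * s)
    rw [AddChar.mulShift_apply] at this
    rw [← this]
    congr 1
    linear_combination (-2 * r * s) * a.mul_inv
  two_mul s := by
    rw [AddChar.mulShift_apply, mul_left_comm]
    exact h.two_mul _
  sq_mul s := by
    rw [AddChar.mulShift_apply, mul_left_comm]
    exact h.sq_mul _

/-- A functional on a projective module with values divisible by `c` is divisible by `c`. -/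
theorem exists_smul_eq_of_dvd {P : Type*} [AddCommGroup P] [Module R P] [Module.Projective R P]
    (c : R) (f : Module.Dual R P) (h : ∀ x, c ∣ f x) : ∃ g : Module.Dual R P, c • g = f := by
  let m : R →ₗ[R] Ideal.span {c} :=
    LinearMap.codRestrict _ (LinearMap.mulLeft R c) fun r =>
      Ideal.mem_span_singleton.2 (Dvd.intro r rfl)
  have hm : Function.Surjective m := by
    rintro ⟨y, hy⟩
    obtain ⟨r, rfl⟩ := Ideal.mem_span_singleton.1 hy
    exact ⟨r, rfl⟩
  obtain ⟨g, hg⟩ := Module.projective_lifting_property m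
    (f.codRestrict (Ideal.span {c}) fun x => Ideal.mem_span_singleton.2 (h x)) hm
  refine ⟨g, LinearMap.ext fun x => ?_⟩
  exact congrArg Subtype.val (DFunLike.congr_fun hg x)

/-! ### Gauss sums -/

variable [Finite R]

theorem USymModule.finite_carrier (M : USymModule R) : Finite M.carrier :=
  Module.finite_of_finite R

attribute [local instance] Fintype.ofFinite USymModule.finite_carrier

/-- The Gauss sum of the quadratic function `x ↦ φ x x` on a unimodular symmetric module. -/
noncomputable def USymModule.gauss (ψ : AddChar R ℂ) (M : USymModule R) : ℂ :=
  ∑ x : M.carrier, ψ (M.form x x)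

theorem gauss_eq_of_iso (ψ : AddChar R ℂ) {M N : USymModule R} (h : Iso M N) :
    M.gauss ψ = N.gauss ψ := by
  obtain ⟨e, he⟩ := h
  exact Fintype.sum_equiv e.toEquiv _ _ fun x => by simp [he]

theorem gauss_orthSum (ψ : AddChar R ℂ) (M N : USymModule R) :
    (orthSum M N).gauss ψ = M.gauss ψ * N.gauss ψ := by
  simp only [gauss]
  rw [Fintype.sum_mul_sum, ← Fintype.sum_prod_type']
  let e : (orthSum M N).carrier ≃ M.carrier × N.carrier := Equiv.refl _
  exact Fintype.sum_equiv e (fun x => ψ ((orthSum M N).form x x))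
    (fun x => ψ (M.form x.1 x.1) * ψ (N.form x.2 x.2))
    fun x => ψ.map_add_eq_mul _ _

theorem gauss_zero (ψ : AddChar R ℂ) : (zero R).gauss ψ = 1 := by
  have : Unique (zero R).carrier := inferInstanceAs (Unique PUnit)
  rw [gauss, Fintype.sum_unique]
  change ψ 0 = 1
  exact ψ.map_zero_eq_one

theorem gauss_rankOne [Fintype R] (ψ : AddChar R ℂ) (a : Rˣ) :
    (rankOne a).gauss ψ = ∑ x : R, ψ (a * (x * x)) :=
  let e : (rankOne a).carrier ≃ R := Equiv.refl R
  Fintype.sum_equiv e (fun x => ψ ((rankOne a).form x x)) _ fun _ => rfl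

theorem gauss_rankOne_tensor (ψ : AddChar R ℂ) (a : Rˣ) (M : USymModule R) :
    ((rankOne a).tensor M).gauss ψ = M.gauss (ψ.mulShift a) := by
  let e : M.carrier ≃ ((rankOne a).tensor M).carrier := (TensorProduct.lid R M.carrier).symm.toEquiv
  refine (Fintype.sum_equiv e _ _ fun x => ?_).symm
  change ψ (a * M.form x x) = ψ (((rankOne a).tensor M).form ((1 : R) ⊗ₜ x) ((1 : R) ⊗ₜ x))
  erw [tensor_form_tmul]
  rw [rankOne_form, mul_one, mul_one]

/-- The Gauss sum as a monoid homomorphism. -/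
noncomputable def gaussMonoidHom (ψ : AddChar R ℂ) : Multiplicative (SymClass R) →* ℂ where
  toFun c := Quotient.lift (gauss ψ) (fun _ _ => gauss_eq_of_iso ψ) c.toAdd
  map_one' := gauss_zero ψ
  map_mul' := by
    rintro ⟨M⟩ ⟨N⟩
    exact gauss_orthSum ψ M N

/-- By stable diagonalization, the Gauss sum times that of some diagonal form is a product of
nonzero rank one sums, so each factor is invertible. -/
theorem isUnit_gaussMonoidHom [IsLocalRing R] (ψ : AddChar R ℂ)
    (hψ : ∀ a : Rˣ, (rankOne a).gauss ψ ≠ 0) (c : Multiplicative (SymClass R)) :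
    IsUnit (gaussMonoidHom ψ c) := by
  have hd : ∀ d ∈ diagClasses R, IsUnit (gaussMonoidHom ψ (.ofAdd d)) := fun d hd => by
    induction hd using AddSubmonoid.closure_induction with
    | mem x hx =>
      obtain ⟨a, rfl⟩ := hx
      exact (hψ a).isUnit
    | zero => rw [ofAdd_zero, map_one]; exact isUnit_one
    | add x y _ _ hx hy => rw [ofAdd_add, map_mul]; exact hx.mul hy
  obtain ⟨M⟩ := c
  obtain ⟨d, hd1, hd2⟩ := exists_add_mem_diagClasses M
  have := hd _ hd2
  rw [ofAdd_add, map_mul] at this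
  exact isUnit_of_mul_isUnit_left this

/-- The Gauss sum as a homomorphism on `GW R`. -/
noncomputable def gaussHom [IsLocalRing R] (ψ : AddChar R ℂ)
    (hψ : ∀ a : Rˣ, (rankOne a).gauss ψ ≠ 0) : GW R →+ Additive ℂˣ :=
  Algebra.GrothendieckAddGroup.lift
    (MonoidHom.toAdditiveRight
      (IsUnit.liftRight (gaussMonoidHom ψ) (isUnit_gaussMonoidHom ψ hψ)))

/-- The Gauss sum of an element of `GW R`, as a complex number. -/
noncomputable def gaussVal [IsLocalRing R] (ψ : AddChar R ℂ)
    (hψ : ∀ a : Rˣ, (rankOne a).gauss ψ ≠ 0) (x : GW R) : ℂ :=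
  ((gaussHom ψ hψ x).toMul : ℂˣ)

section

variable [IsLocalRing R] (ψ : AddChar R ℂ) (hψ : ∀ a : Rˣ, (rankOne a).gauss ψ ≠ 0)

theorem gaussVal_cls (M : USymModule R) : gaussVal ψ hψ (GW.cls M) = M.gauss ψ := by
  rw [gaussVal, gaussHom, GW.cls, groth_lift_of]
  rfl

theorem gaussVal_zero : gaussVal ψ hψ 0 = 1 := by simp [gaussVal]

theorem gaussVal_add (x y : GW R) :
    gaussVal ψ hψ (x + y) = gaussVal ψ hψ x * gaussVal ψ hψ y := by simp [gaussVal]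

theorem gaussVal_neg (x : GW R) : gaussVal ψ hψ (-x) = (gaussVal ψ hψ x)⁻¹ := by
  simp [gaussVal]

theorem gaussVal_sub (x y : GW R) :
    gaussVal ψ hψ (x - y) = gaussVal ψ hψ x / gaussVal ψ hψ y := by
  simp [gaussVal]

theorem gaussVal_zsmul (n : ℤ) (x : GW R) :
    gaussVal ψ hψ (n • x) = gaussVal ψ hψ x ^ n := by
  simp only [gaussVal, map_zsmul, toMul_zsmul, Units.val_zpow_eq_zpow_val]

theorem gaussVal_nsmul (n : ℕ) (x : GW R) :
    gaussVal ψ hψ (n • x) = gaussVal ψ hψ x ^ n := by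
  simp only [gaussVal, map_nsmul, toMul_nsmul, Units.val_pow_eq_pow_val]

end

/-! ### Gauss sums of metabolic modules -/

/-- The hypothesis makes `φ x` divisible by `c` on `L`. As `L` is projective, `φ x = c • g` there,
and `g` is the restriction of some `φ m`. Then `x - c • m` is orthogonal to `L`, hence lies in `L`.
With `x = l + c • m`, the norm is `2cφ(l, m) + c²φ(m, m)`, and `ψ` is trivial on both terms. -/
theorem form_self_eq_one_of_isLagrangian {ψ : AddChar R ℂ} {c : R} (h : IsConductor ψ c)
    {M : USymModule R} {L : Submodule R M.carrier} (hL : M.IsLagrangian L) (x : M.carrier)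
    (hx : ∀ l : L, ψ (2 * M.form x l) = 1) : ψ (M.form x x) = 1 := by
  have := hL.projective
  have hiso : ∀ l ∈ L, ∀ l' ∈ L, M.form l l' = 0 := fun l hl l' hl' =>
    DFunLike.congr_fun (hL.isotropic hl) (⟨l', hl'⟩ : L)
  obtain ⟨g, hg⟩ := exists_smul_eq_of_dvd c (M.toDualOf L x) fun l => h.dvd _ fun s => by
    have := hx (s • l)
    rw [← this]
    congr 1
    change 2 * M.form x l * s = 2 * M.form x (s • (l : M.carrier))
    rw [map_smul, smul_eq_mul]
    ring
  obtain ⟨q, hq⟩ := hL.bijective.2 g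
  obtain ⟨m, rfl⟩ := L.mkQ_surjective q
  have hmg : M.toDualOf L m = g := hq
  have hmem : x - c • m ∈ L := by
    rw [← Submodule.Quotient.mk_eq_zero]
    apply hL.bijective.1
    rw [map_zero]
    change M.toDualOf L (x - c • m) = 0
    rw [map_sub, map_smul, hmg, hg, sub_self]
  obtain ⟨l, hl, rfl⟩ : ∃ l ∈ L, x = l + c • m := ⟨_, hmem, by simp⟩
  have e : M.form (l + c • m) (l + c • m) =
      2 * c * M.form l m + c * c * M.form m m := by
    have h1 := hiso l hl l hl
    have h2 : M.form m l = M.form l m := M.form_comm m l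
    simp only [map_add, map_smul, LinearMap.add_apply, LinearMap.smul_apply, smul_eq_mul, h1, h2]
    ring
  rw [e, ψ.map_add_eq_mul, h.two_mul, h.sq_mul, one_mul]

/-- The Gauss sum of a metabolic module is a positive real number. -/
theorem gauss_pos_of_isMetabolic {ψ : AddChar R ℂ} {c : R} (h : IsConductor ψ c)
    {M : USymModule R} (hM : M.IsMetabolic) : 0 < M.gauss ψ := by
  classical
  obtain ⟨L, hL⟩ := hM
  let χ : M.carrier → AddChar L ℂ := fun x =>
    { toFun := fun l => ψ (2 * M.form x l)
      map_zero_eq_one' := by simp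
      map_add_eq_mul' := fun l l' => by simp [mul_add, ψ.map_add_eq_mul] }
  have key : (Fintype.card L : ℂ) * M.gauss ψ =
      ∑ x : M.carrier, if χ x = 0 then (Fintype.card L : ℂ) else 0 := by
    -- Translation by `l` permutes `M`, and since `φ l l = 0` it multiplies the term of `x` by `χ x
    -- l`.
    have h1 : ∀ l : L, M.gauss ψ = ∑ x : M.carrier, ψ (M.form x x) * χ x l := fun l => by
      refine (Fintype.sum_equiv (Equiv.addRight (l : M.carrier)) _ _ fun x => ?_).symm
      have h1 : M.form l l = 0 := DFunLike.congr_fun (hL.isotropic l.2) l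
      have h2 : M.form l x = M.form x l := M.form_comm l x
      change ψ (M.form x x) * ψ (2 * M.form x l) = ψ (M.form (x + l) (x + l))
      rw [← ψ.map_add_eq_mul]
      congr 1
      simp only [map_add, LinearMap.add_apply, h1, h2]
      ring
    calc (Fintype.card L : ℂ) * M.gauss ψ = ∑ l : L, M.gauss ψ := by simp
      _ = ∑ l : L, ∑ x : M.carrier, ψ (M.form x x) * χ x l :=
        Finset.sum_congr rfl fun l _ => h1 l
      _ = ∑ x : M.carrier, ψ (M.form x x) * ∑ l : L, χ x l := by
        rw [Finset.sum_comm]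
        simp_rw [Finset.mul_sum]
      _ = _ := by
        refine Finset.sum_congr rfl fun x _ => ?_
        rw [AddChar.sum_eq_ite]
        split_ifs with hx
        · rw [form_self_eq_one_of_isLagrangian h hL x fun l => DFunLike.congr_fun hx l, one_mul]
        · rw [mul_zero]
  have hcard : (0 : ℂ) < Fintype.card L := by
    exact_mod_cast Fintype.card_pos
  refine pos_of_mul_pos_right ?_ hcard.le
  rw [key]
  -- By orthogonality of characters all terms are 0 or the cardinality of `L`; the term of `x = 0`
  -- is nonzero.
  refine Finset.sum_pos' (fun x _ => ?_) ⟨0, Finset.mem_univ _, ?_⟩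
  · split_ifs
    · exact hcard.le
    · exact le_rfl
  · rw [if_pos]
    · exact hcard
    · ext l
      simp [χ]

/-- The Gauss sum of an element of the metabolic ideal is a positive real number. -/
theorem gaussVal_pos_of_mem [IsLocalRing R] {ψ : AddChar R ℂ} {c : R} (h : IsConductor ψ c)
    (hψ : ∀ a : Rˣ, (rankOne a).gauss ψ ≠ 0) {x : GW R} (hx : x ∈ metabolicIdeal R) :
    0 < gaussVal ψ hψ x := by
  -- The Gauss sum is not multiplicative for the ring product, so all multiples of `x` are treated
  -- at once to make the induction over the ideal go through.
  suffices ∀ y : GW R, 0 < gaussVal ψ hψ (y * x) by simpa using this 1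
  have hneg : ∀ z : GW R, 0 < gaussVal ψ hψ z → 0 < gaussVal ψ hψ (-z) := fun z hz => by
    rw [gaussVal_neg, RCLike.inv_pos]
    exact hz
  induction hx using Submodule.span_induction with
  | mem x hx =>
    obtain ⟨M, hM, rfl⟩ := hx
    -- The admissible multipliers form a subgroup, so only `y = ⟨a⟩` has to be checked.
    let H : AddSubgroup (GW R) :=
      { carrier := {y | 0 < gaussVal ψ hψ (y * GW.cls M)}
        zero_mem' := by simp [gaussVal_zero]
        add_mem' := fun {y z} hy hz => by
          rw [Set.mem_ofPred_eq, add_mul, gaussVal_add]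
          exact mul_pos hy hz
        neg_mem' := fun {y} hy => by
          rw [Set.mem_ofPred_eq, neg_mul]
          exact hneg _ hy }
    intro y
    refine GW.mem_of_symb_mem H (fun a => ?_) y
    change 0 < gaussVal ψ hψ (GW.symb a * GW.cls M)
    rw [GW.symb, GW.cls, GW.cls, ← groth_of_mul, SymClass.mk_mul]
    change 0 < gaussVal ψ hψ (GW.cls _)
    rw [gaussVal_cls, gauss_rankOne_tensor]
    exact gauss_pos_of_isMetabolic (h.mulShift a) hM
  | zero => simp [gaussVal_zero]
  | add x x' _ _ hx hx' =>
    intro y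
    rw [mul_add, gaussVal_add]
    exact mul_pos (hx y) (hx' y)
  | smul a x _ hx =>
    intro y
    rw [smul_eq_mul, ← mul_assoc]
    exact hx _

end GaussSums

/-! ### Relations between diagonal forms -/

section

variable {R : Type u} [CommRing R]

/-- Nondegeneracy of the source makes any form-preserving map injective, and counting makes it
bijective. -/
theorem iso_of_isometry [Finite R] {M N : USymModule R} (f : M.carrier →ₗ[R] N.carrier)
    (hf : ∀ x y, N.form (f x) (f y) = M.form x y) (hcard : Nat.card M.carrier = Nat.card N.carrier) :
    Iso M N := by
  have := N.finite_carrier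
  have hinj : Function.Injective f := fun x y hxy => M.unimodular.1 <| LinearMap.ext fun z => by
    rw [← hf, ← hf, hxy]
  exact ⟨LinearEquiv.ofBijective f (hinj.bijective_of_nat_card_le hcard.ge), hf⟩

theorem symb_add_symb (a b : Rˣ) :
    GW.symb a + GW.symb b = GW.cls (orthSum (rankOne a) (rankOne b)) := by
  rw [GW.symb, GW.symb, GW.cls, GW.cls, ← map_add]
  rfl

/-- The binary forms `⟨a, b⟩` and `⟨c, d⟩` are isometric if there are orthogonal vectors
`(p, q)`, `(r, s)` of norms `c`, `d` for the first form. -/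
theorem symb_add_symb_eq [Finite R] (a b c d : Rˣ) (p q r s : R)
    (h1 : (a : R) * p ^ 2 + b * q ^ 2 = c) (h2 : (a : R) * r ^ 2 + b * s ^ 2 = d)
    (h3 : (a : R) * (p * r) + b * (q * s) = 0) :
    GW.symb c + GW.symb d = GW.symb a + GW.symb b := by
  rw [symb_add_symb, symb_add_symb]
  refine congrArg Algebra.GrothendieckAddGroup.of (SymClass.mk_eq_mk.2 ?_)
  let f : (R × R) →ₗ[R] (R × R) :=
    { toFun := fun x => (p * x.1 + r * x.2, q * x.1 + s * x.2)
      map_add' := fun x y => by ext <;> simp <;> ring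
      map_smul' := fun t x => by ext <;> simp <;> ring }
  refine iso_of_isometry (M := orthSum (rankOne c) (rankOne d))
    (N := orthSum (rankOne a) (rankOne b)) f (fun (x y : R × R) => ?_) rfl
  change (a : R) * ((p * x.1 + r * x.2) * (p * y.1 + r * y.2)) +
    b * ((q * x.1 + s * x.2) * (q * y.1 + s * y.2)) = c * (x.1 * y.1) + d * (x.2 * y.2)
  linear_combination x.1 * y.1 * h1 + x.2 * y.2 * h2 + (x.1 * y.2 + x.2 * y.1) * h3

/-- Multiplication by a quaternion of norm `3` is a similitude of `⟨1, 1, 1, 1⟩`. -/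
theorem four_smul_symb [Finite R] (a : Rˣ) (ha : (a : R) = 3) :
    4 • GW.symb a = 4 • GW.symb (1 : Rˣ) := by
  have h4 : ∀ b : Rˣ, 4 • GW.symb b = GW.cls (orthSum (orthSum (rankOne b) (rankOne b))
      (orthSum (rankOne b) (rankOne b))) := fun b => by
    have : 4 • GW.symb b = (GW.symb b + GW.symb b) + (GW.symb b + GW.symb b) := by abel
    rw [this, symb_add_symb, GW.cls, GW.cls, ← map_add]
    rfl
  rw [h4, h4]
  refine congrArg Algebra.GrothendieckAddGroup.of (SymClass.mk_eq_mk.2 ?_)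
  -- The columns of this matrix are pairwise orthogonal, each with three entries `±1` and one 0,
  -- hence of norm 3.
  let f : ((R × R) × (R × R)) →ₗ[R] ((R × R) × (R × R)) :=
    { toFun := fun x =>
        ((x.1.1 + x.1.2 - x.2.1, x.1.1 - x.1.2 + x.2.2), (x.1.1 + x.2.1 - x.2.2,
          x.1.2 + x.2.1 + x.2.2))
      map_add' := fun x y => by ext <;> simp <;> ring
      map_smul' := fun t x => by ext <;> simp <;> ring }
  refine iso_of_isometry (M := orthSum (orthSum (rankOne a) (rankOne a))
      (orthSum (rankOne a) (rankOne a)))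
    (N := orthSum (orthSum (rankOne 1) (rankOne 1)) (orthSum (rankOne 1) (rankOne 1)))
    f (fun (x y : (R × R) × (R × R)) => ?_) rfl
  change (((1 : Rˣ) : R) * ((x.1.1 + x.1.2 - x.2.1) * (y.1.1 + y.1.2 - y.2.1)) +
      ((1 : Rˣ) : R) * ((x.1.1 - x.1.2 + x.2.2) * (y.1.1 - y.1.2 + y.2.2))) +
    (((1 : Rˣ) : R) * ((x.1.1 + x.2.1 - x.2.2) * (y.1.1 + y.2.1 - y.2.2)) +
      ((1 : Rˣ) : R) * ((x.1.2 + x.2.1 + x.2.2) * (y.1.2 + y.2.1 + y.2.2))) =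
    ((a : R) * (x.1.1 * y.1.1) + a * (x.1.2 * y.1.2)) +
      ((a : R) * (x.2.1 * y.2.1) + a * (x.2.2 * y.2.2))
  rw [ha, Units.val_one]
  ring

/-- An isotropic vector `v` which spans its own orthogonal complement and pairs to `1` with some
vector spans a lagrangian. -/
theorem isMetabolic_of_vector (M : USymModule R) (v w : M.carrier) (hv : M.form v v = 0)
    (hw : M.form w v = 1) (h : ∀ x, M.form x v = 0 → ∃ t : R, x = t • v) : M.IsMetabolic := by
  let δ : R →ₗ[R] M.carrier := LinearMap.toSpanSingleton R M.carrier v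
  have hδ : Function.Injective δ := fun s t hst => by
    have : M.form w (s • v) = M.form w (t • v) := congrArg (M.form w) hst
    simpa [hw] using this
  let L : Submodule R M.carrier := LinearMap.range δ
  let e : R ≃ₗ[R] L := LinearEquiv.ofInjective δ hδ
  have hiso : L ≤ LinearMap.ker (M.toDualOf L) := by
    rintro _ ⟨s, rfl⟩
    refine LinearMap.mem_ker.2 (LinearMap.ext ?_)
    rintro ⟨_, t, rfl⟩
    change M.form (s • v) (t • v) = 0
    simp [hv]
  refine ⟨L, Module.Finite.equiv e, Module.Projective.of_equiv e, hiso, ?_, ?_⟩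
  · rw [← LinearMap.ker_eq_bot]
    refine Submodule.ker_liftQ_eq_bot _ _ _ fun x hx => ?_
    have h1 : M.form x ((1 : R) • v) = 0 := DFunLike.congr_fun (LinearMap.mem_ker.1 hx) (e 1)
    rw [one_smul] at h1
    obtain ⟨t, rfl⟩ := h x h1
    exact ⟨t, rfl⟩
  · intro f
    refine ⟨Submodule.Quotient.mk (f (e 1) • w), LinearMap.ext fun y => ?_⟩
    obtain ⟨t, rfl⟩ := e.surjective y
    change M.form (f (e 1) • w) (t • v) = f (e t)
    have : f (e t) = t * f (e 1) := by
      rw [← smul_eq_mul, ← map_smul, ← map_smul, smul_eq_mul, mul_one]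
    rw [this]
    simp [hw]

/-- The form `⟨a, -a⟩` is metabolic. -/
theorem isMetabolic_rankOne_neg (a : Rˣ) : (orthSum (rankOne a) (rankOne (-a))).IsMetabolic := by
  have hform : ∀ x y : R × R, (orthSum (rankOne a) (rankOne (-a))).form x y =
      (a : R) * (x.1 * y.1) - a * (x.2 * y.2) := fun x y => by
    change (a : R) * (x.1 * y.1) + ((-a : Rˣ) : R) * (x.2 * y.2) = _
    rw [Units.val_neg]
    ring
  -- The diagonal vector is isotropic, and orthogonality to it reads `a (x.1 - x.2) = 0`, which
  -- forces `x` onto the diagonal.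
  refine isMetabolic_of_vector _ ((1, 1) : R × R) ((↑a⁻¹, 0) : R × R) ?_ ?_
    fun (x : R × R) hx => ⟨x.1, ?_⟩
  · exact (hform _ _).trans (sub_self _)
  · refine (hform _ _).trans ?_
    simp
  · have h1 := (hform x (1, 1)).symm.trans hx
    rw [mul_one, mul_one, ← mul_sub, Units.mul_right_eq_zero] at h1
    change x = (x.1 * 1, x.1 * 1)
    rw [mul_one]
    exact Prod.ext rfl (sub_eq_zero.1 h1).symm

theorem symb_add_symb_neg_mem (a : Rˣ) : GW.symb a + GW.symb (-a) ∈ metabolicIdeal R := by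
  rw [symb_add_symb]
  exact Ideal.subset_span ⟨_, isMetabolic_rankOne_neg a, rfl⟩

theorem toW_symb_neg (a : Rˣ) : GW.toW R (GW.symb (-a)) = -GW.toW R (GW.symb a) := by
  rw [eq_neg_iff_add_eq_zero, add_comm, ← map_add]
  exact Ideal.Quotient.eq_zero_iff_mem.2 (symb_add_symb_neg_mem a)

end

open Complex

/-! ### Homomorphisms from cyclic groups -/

/-- The homomorphism `ZMod n →+ A` which sends `1` to `x`. -/
def zmodHom {A : Type*} [AddCommGroup A] (n : ℕ) (x : A) (h : n • x = 0) : ZMod n →+ A :=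
  ZMod.lift n ⟨zmultiplesHom A x, by simpa using h⟩

theorem zmodHom_natCast {A : Type*} [AddCommGroup A] (n : ℕ) (x : A) (h : n • x = 0) (k : ℕ) :
    zmodHom n x h k = k • x := by
  have := ZMod.lift_coe n ⟨zmultiplesHom A x, by simpa using h⟩ (k : ℤ)
  simpa [zmodHom] using this

theorem zmodHom_one {A : Type*} [AddCommGroup A] (n : ℕ) (x : A) (h : n • x = 0) :
    zmodHom n x h 1 = x := by
  simpa using zmodHom_natCast n x h 1

theorem exists_natCast_eq {n : ℕ} [NeZero n] (a : ZMod n) : ∃ k < n, (k : ZMod n) = a :=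
  ⟨a.val, a.val_lt, ZMod.natCast_zmod_val a⟩

theorem W.mem_of_symb_mem {R : Type*} [CommRing R] [IsLocalRing R] (H : AddSubgroup (W R))
    (h : ∀ a, GW.toW R (GW.symb a) ∈ H) (x : W R) : x ∈ H := by
  obtain ⟨y, rfl⟩ := Ideal.Quotient.mk_surjective x
  exact GW.mem_of_symb_mem (H.comap (GW.toW R).toAddMonoidHom) h y

/-- Compare moduli. This isolates the coefficient of `⟨1⟩`, since the torsion generators have Gauss
values of modulus 1. -/
theorem eq_zero_of_zpow_mul_eq_one {z w : ℂ} {m : ℤ} (h : z ^ m * w = 1) (hz : 1 < normSq z)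
    (hw : normSq w = 1) : m = 0 := by
  have := congrArg normSq h
  rw [map_mul, map_zpow₀, hw, mul_one, map_one] at this
  exact (zpow_eq_one_iff_right₀ (zero_le_one.trans hz.le) hz.ne').1 this

instance : IsLocalRing (ZMod 4) :=
  have : Nontrivial (ZMod 4) := ⟨0, 1, by decide⟩
  IsLocalRing.of_isUnit_or_isUnit_one_sub_self (by decide)

instance : IsLocalRing (ZMod 8) :=
  have : Nontrivial (ZMod 8) := ⟨0, 1, by decide⟩
  IsLocalRing.of_isUnit_or_isUnit_one_sub_self (by decide)

/-! ### The ring `ZMod 4` -/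

section Four

local notation "u₃" => ZMod.unitOfCoprime (n := 4) 3 (by decide)

theorem units_four (a : (ZMod 4)ˣ) : a = 1 ∨ a = u₃ := by
  revert a
  decide

/-- The additive character `x ↦ i ^ x` of `ZMod 4`. -/
noncomputable def char4 : AddChar (ZMod 4) ℂ := AddChar.zmodChar 4 I_pow_four

/-- Modulo 4 the squares are 0 and 1, each taken twice. -/
theorem gauss_char4 (a : (ZMod 4)ˣ) :
    (rankOne a).gauss char4 = 2 * (1 + I ^ (a : ZMod 4).val) := by
  rw [gauss_rankOne]
  simp only [char4, AddChar.zmodChar_apply]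
  refine (Fin.sum_univ_four _).trans ?_
  have h : ∀ a : (ZMod 4)ˣ, ((a : ZMod 4) * (0 * 0)).val = 0 ∧
      ((a : ZMod 4) * (1 * 1)).val = (a : ZMod 4).val ∧
      ((a : ZMod 4) * (2 * 2)).val = 0 ∧
      ((a : ZMod 4) * (3 * 3)).val = (a : ZMod 4).val := by decide
  obtain ⟨h0, h1, h2, h3⟩ := h a
  erw [h0, h1]
  ring

theorem gauss_char4_one : (rankOne (1 : (ZMod 4)ˣ)).gauss char4 = 2 * (1 + I) := by
  rw [gauss_char4]
  change 2 * (1 + I ^ 1) = _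
  rw [pow_one]

theorem gauss_char4_three : (rankOne u₃).gauss char4 = 2 * (1 - I) := by
  rw [gauss_char4]
  change 2 * (1 + I ^ 3) = _
  rw [I_pow_three, sub_eq_add_neg]

theorem gauss_char4_ne_zero (a : (ZMod 4)ˣ) : (rankOne a).gauss char4 ≠ 0 := by
  obtain rfl | rfl := units_four a
  · rw [gauss_char4_one]
    simp [Complex.ext_iff]
  · rw [gauss_char4_three]
    simp [Complex.ext_iff]

theorem isConductor_char4 : IsConductor char4 2 where
  dvd r hr := by
    have h : ∀ r : ZMod 4, 2 ∣ r ∨ ∃ s, 2 * r * s = 2 := by decide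
    obtain h | ⟨s, hs⟩ := h r
    · exact h
    · have := hr s
      rw [hs, char4, AddChar.zmodChar_apply] at this
      change I ^ 2 = 1 at this
      norm_num [I_sq] at this
  two_mul s := by
    have h : ∀ s : ZMod 4, 2 * 2 * s = 0 := by decide
    rw [h, AddChar.map_zero_eq_one]
  sq_mul s := by
    have h : ∀ s : ZMod 4, 2 * 2 * s = 0 := by decide
    rw [h, AddChar.map_zero_eq_one]

theorem gaussVal_char4_one :
    gaussVal char4 gauss_char4_ne_zero (GW.symb 1) = 2 * (1 + I) := by
  rw [GW.symb, gaussVal_cls, gauss_char4_one]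

theorem gaussVal_char4_pfister :
    gaussVal char4 gauss_char4_ne_zero (GW.pfister u₃) = I := by
  have h : (2 * (1 - I) : ℂ) ≠ 0 := by simp [Complex.ext_iff]
  rw [GW.pfister, gaussVal_sub, GW.symb, GW.symb, gaussVal_cls, gaussVal_cls, gauss_char4_one,
    gauss_char4_three, div_eq_iff h]
  linear_combination 2 * I_sq

theorem four_nsmul_pfister_four : 4 • GW.pfister u₃ = 0 := by
  rw [GW.pfister, nsmul_sub, four_smul_symb u₃ rfl, sub_self]

theorem exists_addEquiv_GW_four : ∃ e : ℤ × ZMod 4 ≃+ GW (ZMod 4),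
    e (1, 0) = GW.symb 1 ∧ e (0, 1) = GW.pfister u₃ := by
  let f : ℤ × ZMod 4 →+ GW (ZMod 4) := (zmultiplesHom _ (GW.symb 1)).coprod
    (zmodHom 4 (GW.pfister u₃) four_nsmul_pfister_four)
  have hf1 : f (1, 0) = GW.symb 1 := by simp [f]
  have hf2 : f (0, 1) = GW.pfister u₃ := by simp [f, zmodHom_one]
  have hinj : Function.Injective f := by
    rw [injective_iff_map_eq_zero]
    rintro ⟨m, a⟩ h
    obtain ⟨k, hk, rfl⟩ := exists_natCast_eq a
    have h1 : m • GW.symb (1 : (ZMod 4)ˣ) + k • GW.pfister u₃ = 0 := by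
      rw [← zmodHom_natCast _ _ four_nsmul_pfister_four]
      exact h
    have h2 := congrArg (gaussVal char4 gauss_char4_ne_zero) h1
    rw [gaussVal_add, gaussVal_zsmul, gaussVal_nsmul, gaussVal_zero, gaussVal_char4_one,
      gaussVal_char4_pfister] at h2
    -- The modulus forces `m = 0`; what remains is `I ^ k = 1` with `k < 4`.
    obtain rfl := eq_zero_of_zpow_mul_eq_one h2 (by norm_num [normSq_apply]) (by simp)
    rw [zpow_zero, one_mul] at h2
    have hk0 : k = 0 := by
      interval_cases k
      · rfl
      all_goals norm_num [Complex.ext_iff, pow_succ] at h2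
    simp [hk0]
  have hsurj : Function.Surjective f := by
    refine fun x => GW.mem_of_symb_mem f.range (fun a => ?_) x
    have h1 : GW.symb 1 ∈ f.range := ⟨_, hf1⟩
    have h3 : GW.pfister u₃ ∈ f.range := ⟨_, hf2⟩
    obtain rfl | rfl := units_four a
    · exact h1
    · have : GW.symb u₃ = GW.symb 1 - GW.pfister u₃ := by rw [GW.pfister, sub_sub_cancel]
      rw [this]
      exact sub_mem h1 h3
  exact ⟨AddEquiv.ofBijective f ⟨hinj, hsurj⟩, hf1, hf2⟩

theorem toW_symb_three_four :
    GW.toW (ZMod 4) (GW.symb u₃) = -GW.toW (ZMod 4) (GW.symb 1) := by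
  rw [← toW_symb_neg]
  congr 2

/-- As `3 = -1`, the relation `4⟨3⟩ = 4⟨1⟩` becomes `-4⟨1⟩ = 4⟨1⟩`. -/
theorem eight_nsmul_toW_four : 8 • GW.toW (ZMod 4) (GW.symb 1) = 0 := by
  have h := congrArg (GW.toW (ZMod 4)) (four_smul_symb u₃ rfl)
  rw [map_nsmul, map_nsmul, toW_symb_three_four] at h
  have : ∀ x : W (ZMod 4), 8 • x = 4 • x - 4 • -x := fun x => by abel
  rw [this, h, sub_self]

/-- The argument of `1 + I` is an eighth of a full turn, so its first positive real power of
positive exponent is the eighth. -/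
theorem eq_zero_of_pow_pos {k : ℕ} (hk : k < 8) {t : ℝ} (ht : 0 < t)
    (h : 0 < (t * (1 + I)) ^ k) : k = 0 := by
  have ht' : ((t⁻¹ : ℝ) : ℂ) * t = 1 := by
    rw [← ofReal_mul, inv_mul_cancel₀ ht.ne', ofReal_one]
  have h' : 0 < (1 + I) ^ k := by
    have h0 : (0 : ℂ) < ((t⁻¹ : ℝ) : ℂ) ^ k := by
      rw [← ofReal_pow, zero_lt_real]
      positivity
    have := mul_pos h0 h
    rwa [← mul_pow, ← mul_assoc, ht', one_mul] at this
  interval_cases k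
  · rfl
  all_goals norm_num [Complex.lt_def, pow_succ] at h'

theorem exists_addEquiv_W_four : ∃ e : ZMod 8 ≃+ W (ZMod 4),
    e 1 = GW.toW (ZMod 4) (GW.symb 1) := by
  let f : ZMod 8 →+ W (ZMod 4) := zmodHom 8 _ eight_nsmul_toW_four
  have hf : f 1 = GW.toW (ZMod 4) (GW.symb 1) := zmodHom_one _ _ _
  have hinj : Function.Injective f := by
    rw [injective_iff_map_eq_zero]
    intro a h
    obtain ⟨k, hk, rfl⟩ := exists_natCast_eq a
    rw [zmodHom_natCast, ← map_nsmul] at h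
    have h1 := gaussVal_pos_of_mem isConductor_char4 gauss_char4_ne_zero
      (Ideal.Quotient.eq_zero_iff_mem.1 h)
    rw [gaussVal_nsmul, gaussVal_char4_one] at h1
    rw [eq_zero_of_pow_pos hk (t := 2) two_pos (by exact_mod_cast h1), Nat.cast_zero]
  have hsurj : Function.Surjective f := by
    refine fun x => W.mem_of_symb_mem f.range (fun a => ?_) x
    have h1 : GW.toW (ZMod 4) (GW.symb 1) ∈ f.range := ⟨_, hf⟩
    obtain rfl | rfl := units_four a
    · exact h1
    · rw [toW_symb_three_four]
      exact neg_mem h1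
  exact ⟨AddEquiv.ofBijective f ⟨hinj, hsurj⟩, hf⟩

end Four

/-! ### The ring `ZMod 8` -/

section Eight

local notation "u₃" => ZMod.unitOfCoprime (n := 8) 3 (by decide)

local notation "u₅" => ZMod.unitOfCoprime (n := 8) 5 (by decide)

theorem units_eight (a : (ZMod 8)ˣ) : a = 1 ∨ a = u₃ ∨ a = u₅ ∨ a = -1 := by
  revert a
  decide

/-- Modulo 8 the square 1 is taken four times, and 0 and 4 twice each; an odd `a` fixes 4. -/
theorem gauss_zmodChar_eight {ζ : ℂ} (h : ζ ^ 8 = 1) (a : (ZMod 8)ˣ) :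
    (rankOne a).gauss (AddChar.zmodChar 8 h) = 2 + 4 * ζ ^ (a : ZMod 8).val + 2 * ζ ^ 4 := by
  have hv : ∀ a : (ZMod 8)ˣ, ((a : ZMod 8) * (0 * 0)).val = 0 ∧
      ((a : ZMod 8) * (1 * 1)).val = (a : ZMod 8).val ∧
      ((a : ZMod 8) * (2 * 2)).val = 4 ∧
      ((a : ZMod 8) * (3 * 3)).val = (a : ZMod 8).val ∧
      ((a : ZMod 8) * (4 * 4)).val = 0 ∧
      ((a : ZMod 8) * (5 * 5)).val = (a : ZMod 8).val ∧
      ((a : ZMod 8) * (6 * 6)).val = 4 ∧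
      ((a : ZMod 8) * (7 * 7)).val = (a : ZMod 8).val := by decide
  obtain ⟨h0, h1, h2, h3, h4, h5, h6, h7⟩ := hv a
  have hs : ∀ g : ZMod 8 → ℂ, ∑ x, g x = g 0 + g 1 + g 2 + g 3 + g 4 + g 5 + g 6 + g 7 :=
    Fin.sum_univ_eight
  rw [gauss_rankOne, hs]
  simp only [AddChar.zmodChar_apply, h0, h1, h2, h3, h4, h5, h6, h7]
  ring

theorem exists_pow_four_eq_neg_one : ∃ ζ : ℂ, ζ ^ 4 = -1 :=
  IsAlgClosed.exists_pow_nat_eq _ (by decide)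

/-- A primitive eighth root of unity. -/
noncomputable def zeta : ℂ := exists_pow_four_eq_neg_one.choose

theorem zeta_pow_four : zeta ^ 4 = -1 := exists_pow_four_eq_neg_one.choose_spec

theorem zeta_pow_eight : zeta ^ 8 = 1 := by
  linear_combination (zeta ^ 4 - 1) * zeta_pow_four

theorem zeta_ne_zero : zeta ≠ 0 := fun h => by
  have := zeta_pow_four
  norm_num [h] at this

theorem I_pow_eight : I ^ 8 = 1 := by linear_combination (I ^ 4 + 1) * I_pow_four

/-- The additive character `x ↦ ζ ^ x` of `ZMod 8`. -/
noncomputable def char8 : AddChar (ZMod 8) ℂ := AddChar.zmodChar 8 zeta_pow_eight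

/-- The additive character `x ↦ i ^ x` of `ZMod 8`. -/
noncomputable def char8I : AddChar (ZMod 8) ℂ := AddChar.zmodChar 8 I_pow_eight

theorem gauss_char8 (a : (ZMod 8)ˣ) :
    (rankOne a).gauss char8 = 4 * zeta ^ (a : ZMod 8).val := by
  rw [char8, gauss_zmodChar_eight]
  linear_combination 2 * zeta_pow_four

theorem gauss_char8_ne_zero (a : (ZMod 8)ˣ) : (rankOne a).gauss char8 ≠ 0 := by
  rw [gauss_char8]
  exact mul_ne_zero four_ne_zero (pow_ne_zero _ zeta_ne_zero)

theorem gauss_char8I (a : (ZMod 8)ˣ) :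
    (rankOne a).gauss char8I = 4 * (1 + I ^ (a : ZMod 8).val) := by
  rw [char8I, gauss_zmodChar_eight]
  linear_combination 2 * I_pow_four

theorem gauss_char8I_ne_zero (a : (ZMod 8)ˣ) : (rankOne a).gauss char8I ≠ 0 := by
  rw [gauss_char8I]
  have h : ∀ a : (ZMod 8)ˣ, (a : ZMod 8).val % 4 = 1 ∨ (a : ZMod 8).val % 4 = 3 := by decide
  rw [← Nat.div_add_mod (a : ZMod 8).val 4, pow_add, pow_mul, I_pow_four, one_pow, one_mul]
  obtain h | h := h a
  · simp [h, Complex.ext_iff]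
  · rw [h, I_pow_three]
    simp [Complex.ext_iff]

theorem isConductor_char8 : IsConductor char8 4 where
  dvd r hr := by
    have h : ∀ r : ZMod 8, 4 ∣ r ∨ ∃ s, 2 * r * s = 4 := by decide
    obtain h | ⟨s, hs⟩ := h r
    · exact h
    · have := hr s
      rw [hs, char8, AddChar.zmodChar_apply] at this
      change zeta ^ 4 = 1 at this
      rw [zeta_pow_four] at this
      norm_num at this
  two_mul s := by
    have h : ∀ s : ZMod 8, 2 * 4 * s = 0 := by decide
    rw [h, AddChar.map_zero_eq_one]
  sq_mul s := by
    have h : ∀ s : ZMod 8, 4 * 4 * s = 0 := by decide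
    rw [h, AddChar.map_zero_eq_one]

/-- Here `2 * 2 = 4` is nonzero, but it lies in the kernel of the character, which is all that a
conductor requires. -/
theorem isConductor_char8I : IsConductor char8I 2 := by
  have h4 : ∀ s : ZMod 8, char8I (2 * 2 * s) = 1 := fun s => by
    have h : ∀ s : ZMod 8, (2 * 2 * s).val = 0 ∨ (2 * 2 * s).val = 4 := by decide
    rw [char8I, AddChar.zmodChar_apply]
    obtain h | h := h s
    · rw [h, pow_zero]
    · rw [h, I_pow_four]
  refine ⟨fun r hr => ?_, h4, h4⟩
  have h : ∀ r : ZMod 8, 2 ∣ r ∨ ∃ s, 2 * r * s = 2 := by decide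
  obtain h | ⟨s, hs⟩ := h r
  · exact h
  · have := hr s
    rw [hs, char8I, AddChar.zmodChar_apply] at this
    change I ^ 2 = 1 at this
    norm_num [I_sq] at this

theorem gaussVal_char8_one :
    gaussVal char8 gauss_char8_ne_zero (GW.symb 1) = 4 * zeta := by
  rw [GW.symb, gaussVal_cls, gauss_char8]
  change 4 * zeta ^ 1 = _
  rw [pow_one]

theorem gaussVal_char8_pfister_five :
    gaussVal char8 gauss_char8_ne_zero (GW.pfister u₅) = -1 := by
  rw [GW.pfister, gaussVal_sub, gaussVal_char8_one, GW.symb, gaussVal_cls, gauss_char8,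
    div_eq_iff (mul_ne_zero four_ne_zero (pow_ne_zero _ zeta_ne_zero))]
  change 4 * zeta = -1 * (4 * zeta ^ 5)
  linear_combination 4 * zeta * zeta_pow_four

theorem gaussVal_char8I_one :
    gaussVal char8I gauss_char8I_ne_zero (GW.symb 1) = 4 * (1 + I) := by
  rw [GW.symb, gaussVal_cls, gauss_char8I]
  change 4 * (1 + I ^ 1) = _
  rw [pow_one]

theorem gaussVal_char8I_pfister_three :
    gaussVal char8I gauss_char8I_ne_zero (GW.pfister u₃) = I := by
  rw [GW.pfister, gaussVal_sub, gaussVal_char8I_one, GW.symb, gaussVal_cls,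
    div_eq_iff (gauss_char8I_ne_zero _), gauss_char8I]
  change 4 * (1 + I) = I * (4 * (1 + I ^ 3))
  linear_combination -4 * I_pow_four

theorem gaussVal_char8I_pfister_five :
    gaussVal char8I gauss_char8I_ne_zero (GW.pfister u₅) = 1 := by
  rw [GW.pfister, gaussVal_sub, gaussVal_char8I_one, GW.symb, gaussVal_cls,
    div_eq_iff (gauss_char8I_ne_zero _), gauss_char8I]
  change 4 * (1 + I) = 1 * (4 * (1 + I ^ 5))
  linear_combination -4 * I * I_pow_four

theorem four_nsmul_pfister_three : 4 • GW.pfister u₃ = 0 := by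
  rw [GW.pfister, nsmul_sub, four_smul_symb u₃ rfl, sub_self]

theorem two_nsmul_pfister_five : 2 • GW.pfister u₅ = 0 := by
  have h : GW.symb u₅ + GW.symb u₅ = GW.symb 1 + GW.symb 1 :=
    -- The orthogonal vectors `(1, 2)` and `(-2, 1)` both have norm `1 + 4 = 5`.
    symb_add_symb_eq 1 1 u₅ u₅ 1 2 (-2) 1 (by decide) (by decide) (by decide)
  rw [GW.pfister, nsmul_sub, two_nsmul, two_nsmul, h, sub_self]

theorem symb_neg_one_eight :
    GW.symb (-1 : (ZMod 8)ˣ) = GW.symb 1 + GW.symb u₃ - GW.symb u₅ := by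
  have h : GW.symb u₅ + GW.symb (-1) = GW.symb 1 + GW.symb u₃ :=
    -- For `⟨1, 3⟩` the vectors `(1, 2)` and `(2, 1)` have norms `13 = 5` and `7 = -1`, and pairing
    -- `8 = 0`.
    symb_add_symb_eq 1 u₃ u₅ (-1) 1 2 2 1 (by decide) (by decide) (by decide)
  rw [← h, add_sub_cancel_left]

theorem exists_addEquiv_GW_eight : ∃ e : ℤ × ZMod 4 × ZMod 2 ≃+ GW (ZMod 8),
    e (1, 0, 0) = GW.symb 1 ∧ e (0, 1, 0) = GW.pfister u₃ ∧ e (0, 0, 1) = GW.pfister u₅ := by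
  let f : ℤ × ZMod 4 × ZMod 2 →+ GW (ZMod 8) := (zmultiplesHom _ (GW.symb 1)).coprod
    ((zmodHom 4 (GW.pfister u₃) four_nsmul_pfister_three).coprod
      (zmodHom 2 (GW.pfister u₅) two_nsmul_pfister_five))
  have hf1 : f (1, 0, 0) = GW.symb 1 := by simp [f]
  have hf3 : f (0, 1, 0) = GW.pfister u₃ := by simp [f, zmodHom_one]
  have hf5 : f (0, 0, 1) = GW.pfister u₅ := by simp [f, zmodHom_one]
  have hinj : Function.Injective f := by
    rw [injective_iff_map_eq_zero]
    rintro ⟨m, a, b⟩ h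
    obtain ⟨k, hk, rfl⟩ := exists_natCast_eq a
    obtain ⟨l, hl, rfl⟩ := exists_natCast_eq b
    have h1 : m • GW.symb (1 : (ZMod 8)ˣ) + (k • GW.pfister u₃ + l • GW.pfister u₅) = 0 := by
      rw [← zmodHom_natCast _ _ four_nsmul_pfister_three,
        ← zmodHom_natCast _ _ two_nsmul_pfister_five]
      exact h
    -- `char8I` is blind to `⟨⟨5⟩⟩`, so it determines `m` and `k`; `char8`, which sends `⟨⟨5⟩⟩` to
    -- -1, then determines `l`.
    have h2 := congrArg (gaussVal char8I gauss_char8I_ne_zero) h1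
    rw [gaussVal_add, gaussVal_add, gaussVal_zsmul, gaussVal_nsmul, gaussVal_nsmul,
      gaussVal_zero, gaussVal_char8I_one, gaussVal_char8I_pfister_three,
      gaussVal_char8I_pfister_five, one_pow, mul_one] at h2
    obtain rfl := eq_zero_of_zpow_mul_eq_one h2 (by norm_num [normSq_apply]) (by simp)
    rw [zpow_zero, one_mul] at h2
    obtain rfl : k = 0 := by
      interval_cases k
      · rfl
      all_goals norm_num [Complex.ext_iff, pow_succ] at h2
    have h3 := congrArg (gaussVal char8 gauss_char8_ne_zero) h1
    rw [zero_smul, zero_smul, zero_add, zero_add, gaussVal_nsmul, gaussVal_char8_pfister_five,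
      gaussVal_zero] at h3
    obtain rfl : l = 0 := by
      interval_cases l
      · rfl
      · norm_num at h3
    simp
  have hsurj : Function.Surjective f := by
    refine fun x => GW.mem_of_symb_mem f.range (fun a => ?_) x
    have h1 : GW.symb 1 ∈ f.range := ⟨_, hf1⟩
    have h3 : GW.symb u₃ ∈ f.range := by
      rw [← sub_sub_cancel (GW.symb 1) (GW.symb u₃)]
      exact sub_mem h1 ⟨_, hf3⟩
    have h5 : GW.symb u₅ ∈ f.range := by
      rw [← sub_sub_cancel (GW.symb 1) (GW.symb u₅)]
      exact sub_mem h1 ⟨_, hf5⟩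
    obtain rfl | rfl | rfl | rfl := units_eight a
    · exact h1
    · exact h3
    · exact h5
    · rw [symb_neg_one_eight]
      exact sub_mem (add_mem h1 h3) h5
  exact ⟨AddEquiv.ofBijective f ⟨hinj, hsurj⟩, hf1, hf3, hf5⟩

theorem toW_symb_three_eight :
    GW.toW (ZMod 8) (GW.symb u₃) = -GW.toW (ZMod 8) (GW.symb u₅) := by
  rw [← toW_symb_neg]
  congr 2

theorem two_nsmul_toW_pfister_five : 2 • GW.toW (ZMod 8) (GW.pfister u₅) = 0 := by
  rw [← map_nsmul, two_nsmul_pfister_five, map_zero]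

/-- In the Witt ring `4⟨1⟩ = 4⟨3⟩ = -4⟨5⟩ = -4⟨1⟩`, using `3 = -5` and `2⟨5⟩ = 2⟨1⟩`. -/
theorem eight_nsmul_toW_eight : 8 • GW.toW (ZMod 8) (GW.symb 1) = 0 := by
  have h := congrArg (GW.toW (ZMod 8)) (four_smul_symb u₃ rfl)
  have h5 := two_nsmul_toW_pfister_five
  rw [map_nsmul, map_nsmul, toW_symb_three_eight] at h
  rw [GW.pfister, map_sub] at h5
  have : ∀ x y : W (ZMod 8), 8 • x = (4 • x - 4 • -y) + 2 • 2 • (x - y) := fun x y => by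
    simp only [nsmul_eq_mul]
    push_cast
    ring
  rw [this _ (GW.toW (ZMod 8) (GW.symb u₅)), h, sub_self, h5, smul_zero, add_zero]

theorem exists_addEquiv_W_eight : ∃ e : ZMod 8 × ZMod 2 ≃+ W (ZMod 8),
    e (1, 0) = GW.toW (ZMod 8) (GW.symb 1) ∧
    e (0, 1) = GW.toW (ZMod 8) (GW.pfister u₅) := by
  let f : ZMod 8 × ZMod 2 →+ W (ZMod 8) :=
    (zmodHom 8 _ eight_nsmul_toW_eight).coprod (zmodHom 2 _ two_nsmul_toW_pfister_five)
  have hf1 : f (1, 0) = GW.toW (ZMod 8) (GW.symb 1) := by simp [f, zmodHom_one]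
  have hf5 : f (0, 1) = GW.toW (ZMod 8) (GW.pfister u₅) := by simp [f, zmodHom_one]
  have hinj : Function.Injective f := by
    rw [injective_iff_map_eq_zero]
    rintro ⟨a, b⟩ h
    obtain ⟨k, hk, rfl⟩ := exists_natCast_eq a
    obtain ⟨l, hl, rfl⟩ := exists_natCast_eq b
    have h1 : GW.toW (ZMod 8) (k • GW.symb 1 + l • GW.pfister u₅) = 0 := by
      rw [map_add, map_nsmul, map_nsmul, ← zmodHom_natCast _ _ eight_nsmul_toW_eight,
        ← zmodHom_natCast _ _ two_nsmul_toW_pfister_five]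
      exact h
    have hmem := Ideal.Quotient.eq_zero_iff_mem.1 h1
    -- Under `char8` both `4⟨1⟩` and `⟨⟨5⟩⟩` have negative value; `char8I` gives 1 on `⟨⟨5⟩⟩`, so it
    -- settles `k` first.
    have h2 := gaussVal_pos_of_mem isConductor_char8I gauss_char8I_ne_zero hmem
    rw [gaussVal_add, gaussVal_nsmul, gaussVal_nsmul, gaussVal_char8I_one,
      gaussVal_char8I_pfister_five, one_pow, mul_one] at h2
    obtain rfl := eq_zero_of_pow_pos hk (t := 4) four_pos (by exact_mod_cast h2)
    have h3 := gaussVal_pos_of_mem isConductor_char8 gauss_char8_ne_zero hmem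
    rw [zero_smul, zero_add, gaussVal_nsmul, gaussVal_char8_pfister_five] at h3
    obtain rfl : l = 0 := by
      interval_cases l
      · rfl
      · norm_num [Complex.lt_def] at h3
    simp
  have hsurj : Function.Surjective f := by
    refine fun x => W.mem_of_symb_mem f.range (fun a => ?_) x
    have h1 : GW.toW (ZMod 8) (GW.symb 1) ∈ f.range := ⟨_, hf1⟩
    have h5 : GW.toW (ZMod 8) (GW.symb u₅) ∈ f.range := by
      have h : GW.symb u₅ = GW.symb 1 - GW.pfister u₅ := by rw [GW.pfister, sub_sub_cancel]
      rw [h, map_sub]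
      exact sub_mem h1 ⟨_, hf5⟩
    obtain rfl | rfl | rfl | rfl := units_eight a
    · exact h1
    · rw [toW_symb_three_eight]
      exact neg_mem h5
    · exact h5
    · rw [toW_symb_neg]
      exact neg_mem h1
  exact ⟨AddEquiv.ofBijective f ⟨hinj, hsurj⟩, hf1, hf5⟩

end Eight

end SymForms

theorem mainTheorem4 :
    (∃ e : ℤ × ZMod 4 ≃+ SymForms.GW (ZMod 4),
      e (1, 0) = SymForms.GW.symb 1 ∧
      e (0, 1) = SymForms.GW.pfister (ZMod.unitOfCoprime 3 (by decide))) ∧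
    (∃ e : ℤ × ZMod 4 × ZMod 2 ≃+ SymForms.GW (ZMod 8),
      e (1, 0, 0) = SymForms.GW.symb 1 ∧
      e (0, 1, 0) = SymForms.GW.pfister (ZMod.unitOfCoprime 3 (by decide)) ∧
      e (0, 0, 1) = SymForms.GW.pfister (ZMod.unitOfCoprime 5 (by decide))) ∧
    (∃ e : ZMod 8 ≃+ SymForms.W (ZMod 4),
      e 1 = SymForms.GW.toW (ZMod 4) (SymForms.GW.symb 1)) ∧
    (∃ e : ZMod 8 × ZMod 2 ≃+ SymForms.W (ZMod 8),
      e (1, 0) = SymForms.GW.toW (ZMod 8) (SymForms.GW.symb 1) ∧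
      e (0, 1) = SymForms.GW.toW (ZMod 8)
        (SymForms.GW.pfister (ZMod.unitOfCoprime 5 (by decide)))) := by
  exact ⟨SymForms.exists_addEquiv_GW_four, SymForms.exists_addEquiv_GW_eight,
    SymForms.exists_addEquiv_W_four, SymForms.exists_addEquiv_W_eight⟩
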